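/- Let $A$ be a separable (not necessarily unital) C*-algebra and let $\alpha\colon G\to\operatorname{Aut}(A)$ be an action of a group $G$ on $A$ by $*$-automorphisms. A primitive ideal of $A$ is the kernel of a (nonzero) irreducible $*$-representation of $A$ on a Hilbert space. A closed two-sided ideal $I$ of $A$ is called $G$-invariant if $\alpha_g(I)=I$ for all $g\in G$. A $G$-invariant closed ideal $I$ is called $G$-prime if it is proper, $I\neq A$, and whenever $J_1,J_2$ are $G$-invariant closed ideals of $A$ with $J_1\cap J_2\subseteq I$, then $J_1\subseteq I$ or $J_2\subseteq I$. It is called $G$-primitive if $I=P^G:=\bigcap_{g\in G}\alpha_g(P)$ for some primitive ideal $P$ of $A$. Then $$\operatorname{Prime}^G(A)=\operatorname{Prim}^G(A),$$ that is, a $G$-invariant closed ideal of $A$ is $G$-prime if and only if it is $G$-primitive. -/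

import Mathlib

namespace CStarSystem

universe u v

/-- A star representation of a (possibly non-unital) C*-algebra on a complex Hilbert space is
irreducible if it is not the zero representation and the only closed invariant subspaces are `0`
and the whole space. (Being nonzero excludes both the zero space and the degenerate zero
representation on a one-dimensional space.) -/
def IsIrreducibleRep {A : Type u} [NonUnitalCStarAlgebra A]
    {H : Type v} [NormedAddCommGroup H] [InnerProductSpace ℂ H] [CompleteSpace H]
    (π : A →⋆ₙₐ[ℂ] (H →L[ℂ] H)) : Prop :=
  π ≠ 0 ∧ ∀ K : Submodule ℂ H, IsClosed (K : Set H) →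
    (∀ a : A, ∀ x ∈ K, π a x ∈ K) → K = ⊥ ∨ K = ⊤

/-- `Prim(A)`: the kernels of the irreducible representations of `A`. The Hilbert space of an
irreducible representation is the closure of the orbit of any one nonzero vector under `A`, so
nothing is lost by taking Hilbert spaces in the universe of `A`. -/
def primitiveIdeals (A : Type u) [NonUnitalCStarAlgebra A] : Set (TwoSidedIdeal A) :=
  {P | ∃ (H : Type u) (_ : NormedAddCommGroup H) (_ : InnerProductSpace ℂ H)
      (_ : CompleteSpace H) (π : A →⋆ₙₐ[ℂ] (H →L[ℂ] H)),
      IsIrreducibleRep π ∧ P = TwoSidedIdeal.ker π}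

variable {A : Type u} [NonUnitalCStarAlgebra A] {G : Type v} [Group G]

/-- The closed two-sided ideals `I` of `A` with `α_g(I) = I` for all `g`. (A norm-closed two-sided
ring ideal of a C*-algebra is automatically a complex linear subspace, thanks to approximate
units.) -/
def invariantIdeals (α : G →* (A ≃⋆ₐ[ℂ] A)) : Set (TwoSidedIdeal A) :=
  {I | IsClosed (I : Set A) ∧ ∀ g : G, α g '' (I : Set A) = I}

/-- `Prime^G(A)`: the `G`-prime ideals, that is, the proper closed `G`-invariant ideals `I` such
that `J₁ ∩ J₂ ⊆ I` implies `J₁ ⊆ I` or `J₂ ⊆ I` for closed `G`-invariant ideals `J₁`, `J₂`. -/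
def gPrimeIdeals (α : G →* (A ≃⋆ₐ[ℂ] A)) : Set (TwoSidedIdeal A) :=
  {I | I ∈ invariantIdeals α ∧ I ≠ ⊤ ∧
    ∀ J₁ ∈ invariantIdeals α, ∀ J₂ ∈ invariantIdeals α, J₁ ⊓ J₂ ≤ I → J₁ ≤ I ∨ J₂ ≤ I}

/-- `Prim^G(A)`: the `G`-primitive ideals, that is, the closed `G`-invariant ideals of the form
`P^G = ⋂_g α_g(P)` with `P` a primitive ideal of `A`. -/
def gPrimitiveIdeals (α : G →* (A ≃⋆ₐ[ℂ] A)) : Set (TwoSidedIdeal A) :=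
  {I | I ∈ invariantIdeals α ∧
    ∃ P ∈ primitiveIdeals A, (I : Set A) = ⋂ g : G, α g '' (P : Set A)}

end CStarSystem

/-!
A primitive ideal `P` is prime, since the vectors killed by an ideal form a closed invariant
subspace of an irreducible representation; this passes to `P^G`, because an invariant ideal inside
`P` lies inside every translate of `P`.

Conversely, let `I` be `G`-prime and let `b n` be countably many elements outside `I`. The usual
argument finds a primitive ideal `P ⊇ I` such that each `b n` has a translate outside `P` by a Baire
category argument on the primitive ideal space. Here a nested sequence of faces replaces it.
If `x` and `b` lie outside `I`, then `x * a * α g b ∉ I` for some `a` and `g`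
(`exists_mul_mul_action_notMem`); functional calculus turns this into contractions `c n` in the ideal
generated by a translate of `b n`, and elements `d n ∉ I`, with `c k * d n = d n` for `k ≤ n`
(`exists_unit_step`). The quasi-states that vanish on `I` and equal one at `c 0, …, c n` form a
weak* closed face of the quasi-states. It is nonempty: a positive functional vanishing on `I` but not
at `star (d n) * d n` exists by the Hahn–Banach theorem (`exists_positive_functional`), and
compressing it by `d n` gives a member (`exists_quasiState`). By compactness and the Krein–Milman
theorem the intersection of these faces has an extreme point; its GNS representation is irreducible
(`isIrreducibleRep_gns`), annihilates `I` and does not annihilate any `c n`.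

For separable `A`, take for the `b n` those elements `(star a * a - δ)₊` outside `I` with `a` in a
countable dense set and `δ = 1 / (m + 1)`. An element `x` of `P^G` outside `I` would be approximated
by such an `a` with `(star a * a - δ)₊ ∉ I`, and then every translate of `(star a * a - δ)₊` would be
in `P`, contrary to the choice of `P`.
-/

namespace CStarSystem

open scoped ComplexOrder InnerProductSpace CStarAlgebra
open UniformSpace

universe u v

/-! ### Cutoffs by functional calculus -/

section Cutoff

variable {A : Type u} [NonUnitalCStarAlgebra A]

lemma norm_le_of_mem_quasispectrum {a : A} (ha : IsSelfAdjoint a) {t : ℝ}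
    (ht : t ∈ quasispectrum ℝ a) : ‖t‖ ≤ ‖a‖ := by
  simpa [cfcₙ_id' ℝ a] using norm_apply_le_norm_cfcₙ (fun x : ℝ ↦ x) a ht

lemma nonneg_of_mem_quasispectrum_star_mul_self (a : A) {t : ℝ}
    (ht : t ∈ quasispectrum ℝ (star a * a)) : 0 ≤ t := by
  let := CStarAlgebra.spectralOrder A
  have := CStarAlgebra.spectralOrderedRing A
  exact quasispectrum_nonneg_of_nonneg _ (star_mul_self_nonneg a) t ht

/-- The truncation `h ↦ (h - μ)₊`. -/
noncomputable def truncate (μ : ℝ) (h : A) : A := cfcₙ (fun t : ℝ ↦ max (t - μ) 0) h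

/-- The function `t ↦ t / max(t, μ)²`, so that `h * reciprocalCutoff μ h` is the functional
calculus of `min(t / μ, 1)²` on positive `h`: a contraction acting as a unit on `(h - μ)₊`. -/
noncomputable def reciprocalCutoff (μ : ℝ) (h : A) : A :=
  cfcₙ (fun t : ℝ ↦ t / (max t μ) ^ 2) h

lemma continuous_div_max_sq {μ : ℝ} (hμ : 0 < μ) :
    Continuous (fun t : ℝ ↦ t / (max t μ) ^ 2) := by
  refine continuous_id.div (by fun_prop) fun t ↦ ?_
  have : 0 < max t μ := lt_max_of_lt_right hμ
  positivity

lemma mul_reciprocalCutoff {μ : ℝ} (hμ : 0 < μ) {h : A} (hh : IsSelfAdjoint h) :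
    h * reciprocalCutoff μ h = cfcₙ (fun t : ℝ ↦ t * (t / (max t μ) ^ 2)) h := by
  have hc := continuous_div_max_sq hμ
  rw [cfcₙ_mul (fun t : ℝ ↦ t) _ h (by fun_prop) rfl hc.continuousOn (by simp), cfcₙ_id' ℝ h,
    reciprocalCutoff]

lemma isSelfAdjoint_mul_reciprocalCutoff {μ : ℝ} (hμ : 0 < μ) {h : A} (hh : IsSelfAdjoint h) :
    IsSelfAdjoint (h * reciprocalCutoff μ h) := by
  rw [mul_reciprocalCutoff hμ hh]
  exact cfcₙ_predicate _ h

lemma norm_mul_reciprocalCutoff_le_one {μ : ℝ} (hμ : 0 < μ) (a : A) :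
    ‖(star a * a) * reciprocalCutoff μ (star a * a)‖ ≤ 1 := by
  rw [mul_reciprocalCutoff hμ (.star_mul_self a)]
  refine norm_cfcₙ_le fun t ht ↦ ?_
  have h0 := nonneg_of_mem_quasispectrum_star_mul_self a ht
  have hm : 0 < max t μ := lt_max_of_lt_right hμ
  rw [Real.norm_of_nonneg (by positivity), ← mul_div_assoc, div_le_one (by positivity), ← sq]
  gcongr
  exact le_max_left _ _

/-- `a` is almost fixed by a cutoff of `star a * a`, because `t (1 - min(t/μ, 1)²)² ≤ μ` for
`t ≥ 0`. -/
lemma norm_sub_mul_reciprocalCutoff_sq_le {μ : ℝ} (hμ : 0 < μ) (a : A) :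
    ‖a - a * ((star a * a) * reciprocalCutoff μ (star a * a))‖ ^ 2 ≤ μ := by
  set h := star a * a with hh
  have hsa : IsSelfAdjoint h := .star_mul_self a
  have hc := continuous_div_max_sq hμ
  have hw := isSelfAdjoint_mul_reciprocalCutoff hμ hsa
  have key : star (a - a * (h * reciprocalCutoff μ h)) * (a - a * (h * reciprocalCutoff μ h)) =
      cfcₙ (fun t : ℝ ↦ (t - t * (t * (t / (max t μ) ^ 2))) -
        (t * (t / (max t μ) ^ 2)) * (t - t * (t * (t / (max t μ) ^ 2)))) h := by
    have e1 : cfcₙ (fun t : ℝ ↦ t - t * (t * (t / (max t μ) ^ 2))) h =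
        h - h * (h * reciprocalCutoff μ h) := by
      rw [cfcₙ_sub (fun t : ℝ ↦ t) _ h (by fun_prop) rfl (by fun_prop) (by simp),
        cfcₙ_mul (fun t : ℝ ↦ t) _ h (by fun_prop) rfl (by fun_prop) (by simp), cfcₙ_id' ℝ h,
        mul_reciprocalCutoff hμ hsa]
    rw [cfcₙ_sub _ _ h (by fun_prop) (by simp) (by fun_prop) (by simp),
      cfcₙ_mul _ _ h (by fun_prop) (by simp) (by fun_prop) (by simp), e1,
      ← mul_reciprocalCutoff hμ hsa]
    generalize h * reciprocalCutoff μ h = w at hw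
    rw [star_sub, star_mul, hw.star_eq, hh]
    simp only [mul_sub, sub_mul, mul_assoc]
    abel
  rw [sq, ← CStarRing.norm_star_mul_self, key]
  refine norm_cfcₙ_le fun t ht ↦ ?_
  have h0 := nonneg_of_mem_quasispectrum_star_mul_self a ht
  rcases le_total μ t with h1 | h1
  · have : t ≠ 0 := by linarith
    rw [max_eq_left h1, show t * (t / t ^ 2) = 1 by field_simp]
    simpa using hμ.le
  · rw [max_eq_right h1]
    set s := t * (t / μ ^ 2) with hs
    have hs0 : 0 ≤ s := by positivity
    have hs1 : s ≤ 1 := by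
      rw [hs, ← mul_div_assoc, div_le_one (by positivity)]; nlinarith
    rw [show t - t * s - s * (t - t * s) = t * ((1 - s) * (1 - s)) by ring,
      Real.norm_of_nonneg (mul_nonneg h0 (mul_self_nonneg _))]
    have : (1 - s) * (1 - s) ≤ 1 := by nlinarith
    nlinarith

/-- Every element `a` has approximate right units in the ideal generated by `star a * a`. -/
lemma exists_approx_right_unit (a : A) {ε : ℝ} (hε : 0 < ε) :
    ∃ y : A, IsSelfAdjoint (star a * a * y) ∧ ‖star a * a * y‖ ≤ 1 ∧
      ‖a - a * (star a * a * y)‖ < ε := by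
  have hμ : 0 < (ε / 2) ^ 2 := by positivity
  refine ⟨reciprocalCutoff ((ε / 2) ^ 2) (star a * a),
    isSelfAdjoint_mul_reciprocalCutoff hμ (.star_mul_self a),
    norm_mul_reciprocalCutoff_le_one hμ a, ?_⟩
  have := norm_sub_mul_reciprocalCutoff_sq_le hμ a
  have := abs_le_of_sq_le_sq this (by positivity)
  linarith [le_abs_self ‖a - a * (star a * a * reciprocalCutoff ((ε / 2) ^ 2) (star a * a))‖]

lemma norm_sub_truncate_le {μ : ℝ} (hμ : 0 ≤ μ) (a : A) :
    ‖star a * a - truncate μ (star a * a)‖ ≤ μ := by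
  have hsa : IsSelfAdjoint (star a * a) := .star_mul_self a
  have : star a * a - truncate μ (star a * a) =
      cfcₙ (fun t : ℝ ↦ t - max (t - μ) 0) (star a * a) := by
    rw [cfcₙ_sub (fun t : ℝ ↦ t) _ _ (by fun_prop) rfl (by fun_prop) (by simpa using hμ),
      cfcₙ_id' ℝ (star a * a), truncate]
  rw [this]
  refine norm_cfcₙ_le fun t ht ↦ ?_
  have h0 := nonneg_of_mem_quasispectrum_star_mul_self a ht
  rcases le_total μ t with h1 | h1
  · rw [max_eq_left (by linarith)]
    simp [abs_of_nonneg hμ]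
  · rw [max_eq_right (by linarith)]
    simpa [abs_of_nonneg h0] using h1

lemma mul_reciprocalCutoff_mul_truncate {μ : ℝ} (hμ : 0 < μ) {h : A} (hh : IsSelfAdjoint h) :
    h * reciprocalCutoff μ h * truncate μ h = truncate μ h := by
  have hc := continuous_div_max_sq hμ
  rw [mul_reciprocalCutoff hμ hh, truncate,
    ← cfcₙ_mul _ _ h (by fun_prop) (by simp) (by fun_prop) (by simpa using hμ.le)]
  congr 1
  ext t
  rcases le_total t μ with h1 | h1
  · rw [max_eq_right (b := (0 : ℝ)) (by linarith)]; simp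
  · have : t ≠ 0 := by linarith
    rw [max_eq_left h1, show t * (t / t ^ 2) = 1 by field_simp, one_mul]

lemma exists_truncate_eq_mul {μ : ℝ} (hμ : 0 < μ) {h : A} (hh : IsSelfAdjoint h) :
    ∃ r : A, truncate μ h = h * r := by
  refine ⟨reciprocalCutoff μ h * truncate μ h, ?_⟩
  rw [← mul_assoc, mul_reciprocalCutoff_mul_truncate hμ hh]

/-- Truncating at a level above the norm of the image gives an element of the kernel. -/
lemma map_truncate_eq_zero {B : Type v} [NonUnitalCStarAlgebra B] (π : A →⋆ₙₐ[ℂ] B) {μ : ℝ}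
    (hμ : 0 ≤ μ) {h : A} (hh : IsSelfAdjoint h) (hπ : ‖π h‖ ≤ μ) : π (truncate μ h) = 0 := by
  have hπh : IsSelfAdjoint (π h) := hh.map π
  rw [truncate, NonUnitalStarAlgHom.map_cfcₙ π _ h (by fun_prop) (by simpa using hμ)
    (map_continuous π) hh hπh]
  have : (quasispectrum ℝ (π h)).EqOn (fun t : ℝ ↦ max (t - μ) 0) (fun _ ↦ 0) := fun t ht ↦ by
    have := norm_le_of_mem_quasispectrum hπh ht
    exact max_eq_right (by linarith [le_abs_self t, Real.norm_eq_abs t])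
  rw [cfcₙ_congr this, cfcₙ_const_zero]

end Cutoff

/-! ### Closed two-sided ideals -/

section ClosedIdeal

variable {A : Type u} [NonUnitalCStarAlgebra A] {I : TwoSidedIdeal A}

lemma mem_of_forall_exists_norm_sub_lt (hI : IsClosed (I : Set A)) {a : A}
    (h : ∀ ε > 0, ∃ b ∈ I, ‖a - b‖ < ε) : a ∈ I := by
  have : a ∈ closure (I : Set A) := Metric.mem_closure_iff.2 fun ε hε ↦ by
    obtain ⟨b, hb, hab⟩ := h ε hε
    exact ⟨b, hb, by rwa [dist_eq_norm]⟩
  rwa [hI.closure_eq] at this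

lemma mem_of_star_mul_self_mem (hI : IsClosed (I : Set A)) {a : A} (h : star a * a ∈ I) :
    a ∈ I :=
  mem_of_forall_exists_norm_sub_lt hI fun ε hε ↦ by
    obtain ⟨y, -, -, hy⟩ := exists_approx_right_unit a hε
    exact ⟨_, I.mul_mem_left _ _ (I.mul_mem_right _ _ h), hy⟩

lemma smul_mem_of_isClosed (hI : IsClosed (I : Set A)) {a : A} (h : a ∈ I) (r : ℂ) :
    r • a ∈ I :=
  mem_of_forall_exists_norm_sub_lt hI fun ε hε ↦ by
    obtain ⟨y, -, -, hy⟩ := exists_approx_right_unit a (ε := ε / (‖r‖ + 1)) (by positivity)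
    refine ⟨a * (r • (star a * a * y)), I.mul_mem_right _ _ h, ?_⟩
    rw [mul_smul_comm, ← smul_sub, norm_smul]
    rw [lt_div_iff₀ (by positivity)] at hy
    nlinarith [norm_nonneg (a - a * (star a * a * y))]

lemma star_mem_of_isClosed (hI : IsClosed (I : Set A)) {a : A} (h : a ∈ I) : star a ∈ I :=
  mem_of_forall_exists_norm_sub_lt hI fun ε hε ↦ by
    obtain ⟨y, hsa, -, hy⟩ := exists_approx_right_unit a hε
    refine ⟨star a * a * y * star a,
      I.mul_mem_right _ _ (I.mul_mem_right _ _ (I.mul_mem_left _ _ h)), ?_⟩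
    rwa [← norm_star, star_sub, star_mul, star_star, hsa.star_eq]

/-- Closed ideals are semiprime. -/
lemma mem_of_forall_mul_mul_mem (hI : IsClosed (I : Set A)) {a : A} (h : ∀ x, a * x * a ∈ I) :
    a ∈ I := by
  refine mem_of_star_mul_self_mem hI (mem_of_star_mul_self_mem hI ?_)
  rw [star_mul, star_star, mul_assoc, ← mul_assoc a]
  exact I.mul_mem_left _ _ (h _)

lemma exists_truncate_notMem (hI : IsClosed (I : Set A)) {a : A} (h : star a * a ∉ I) :
    ∃ μ > 0, truncate μ (star a * a) ∉ I := by
  by_contra! H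
  refine h (mem_of_forall_exists_norm_sub_lt hI fun ε hε ↦ ?_)
  exact ⟨_, H (ε / 2) (by positivity),
    (norm_sub_truncate_le (by positivity) a).trans_lt (by linarith)⟩

end ClosedIdeal

/-! ### Positive functionals annihilating a closed ideal -/

section Functionals

variable {A : Type u} [NonUnitalCStarAlgebra A] [PartialOrder A] [StarOrderedRing A]
  {I : TwoSidedIdeal A}

/-- If `star d * d` is dominated by an element of `I` up to a small error, then `d` is close to
`I`. Conjugating by
`1 - w`, where `w ∈ I` is an approximate unit for the dominating element, makes that element
small. -/
lemma exists_mem_norm_sub_sq_le {d j z : A} {ε : ℝ} (hε : 0 < ε) (hj : j ∈ I)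
    (hz : ‖z‖ ≤ ε) (hle : star d * d ≤ j + z) : ∃ b ∈ I, ‖d - b‖ ^ 2 ≤ 6 * ε := by
  obtain ⟨y, hw, hw1, hjw⟩ := exists_approx_right_unit j hε
  set w := star j * j * y with hwdef
  have hwI : w ∈ I := I.mul_mem_right _ _ (I.mul_mem_left _ _ hj)
  refine ⟨d * w, I.mul_mem_left _ _ hwI, ?_⟩
  obtain ⟨q, hq⟩ := CStarAlgebra.nonneg_iff_eq_star_mul_self.1 (sub_nonneg.2 hle)
  have hbound : ∀ x : A, ‖x - w * x‖ ≤ 2 * ‖x‖ := fun x ↦ by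
    refine (norm_sub_le _ _).trans ?_
    have := norm_mul_le w x
    nlinarith [norm_nonneg x]
  have hbound' : ∀ x : A, ‖x - x * w‖ ≤ 2 * ‖x‖ := fun x ↦ by
    refine (norm_sub_le _ _).trans ?_
    have := norm_mul_le x w
    nlinarith [norm_nonneg x]
  have e1 : star (d - d * w) * (d - d * w) + star (q - q * w) * (q - q * w) =
      ((j - j * w) - w * (j - j * w)) + ((z - z * w) - w * (z - z * w)) := by
    have : ∀ x : A, star (x - x * w) * (x - x * w) =
        (star x * x - star x * x * w) - w * (star x * x - star x * x * w) := fun x ↦ by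
      rw [star_sub, star_mul, hw.star_eq]
      simp only [mul_sub, sub_mul, mul_assoc]
      abel
    rw [this, this, ← hq]
    simp only [mul_sub, sub_mul, add_mul, mul_add]
    abel
  have h2 : star (d - d * w) * (d - d * w) ≤
      ((j - j * w) - w * (j - j * w)) + ((z - z * w) - w * (z - z * w)) := by
    rw [← e1]
    exact le_add_of_nonneg_right (star_mul_self_nonneg _)
  have h3 := CStarAlgebra.norm_le_norm_of_nonneg_of_le (star_mul_self_nonneg _) h2
  rw [CStarRing.norm_star_mul_self, ← sq] at h3
  have h4 := norm_add_le ((j - j * w) - w * (j - j * w)) ((z - z * w) - w * (z - z * w))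
  have h5 := hbound (j - j * w)
  have h6 := hbound (z - z * w)
  have h7 := hbound' z
  linarith

/-- Hahn–Banach: a closed ideal not containing `d` is annihilated by a positive functional that
does not annihilate `star d * d`. -/
lemma exists_positive_functional (hI : IsClosed (I : Set A)) {d : A} (hd : d ∉ I) :
    ∃ φ : A →ₚ[ℂ] ℂ, (∀ a ∈ I, φ a = 0) ∧ 0 < φ (star d * d) := by
  obtain ⟨ε, hε, hdist⟩ : ∃ ε > 0, ∀ b ∈ I, 6 * ε < ‖d - b‖ ^ 2 := by
    by_contra! H
    refine hd (mem_of_forall_exists_norm_sub_lt hI fun ε hε ↦ ?_)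
    obtain ⟨b, hb, hb'⟩ := H ((ε / 2) ^ 2 / 6) (by positivity)
    refine ⟨b, hb, ?_⟩
    have := abs_le_of_sq_le_sq (a := ‖d - b‖) (b := ε / 2) (by linarith) (by positivity)
    linarith [le_abs_self ‖d - b‖]
  let s : Set A := {x | ∃ p i : A, 0 ≤ p ∧ i ∈ I ∧ x = p + i}
  have hs : Convex ℝ s := by
    rintro _ ⟨p, i, hp, hi, rfl⟩ _ ⟨p', i', hp', hi', rfl⟩ r r' hr hr' -
    refine ⟨r • p + r' • p', r • i + r' • i', by positivity, I.add_mem ?_ ?_, by module⟩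
    · simpa using smul_mem_of_isClosed hI hi (r : ℂ)
    · simpa using smul_mem_of_isClosed hI hi' (r' : ℂ)
  have hdisj : Disjoint (Metric.ball (-(star d * d)) ε) s := by
    rw [Set.disjoint_left]
    rintro x hx ⟨p, i, hp, hi, rfl⟩
    rw [Metric.mem_ball, dist_eq_norm] at hx
    obtain ⟨b, hb, hb'⟩ := exists_mem_norm_sub_sq_le (I := I) (d := d) (j := -i)
      (z := p + i - -(star d * d)) hε (I.neg_mem hi) hx.le
      (by rw [← sub_nonneg]; convert hp using 1; abel)
    exact absurd hb' (not_le.2 (hdist b hb))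
  obtain ⟨f, r, hf1, hf2⟩ := RCLike.geometric_hahn_banach_open (𝕜 := ℂ)
    (convex_ball _ _) Metric.isOpen_ball hs hdisj
  have hfs : ∀ x ∈ s, 0 ≤ (f x).re := by
    rintro x ⟨p, i, hp, hi, rfl⟩
    by_contra! hneg
    -- scaling `x` by a large factor would make the functional arbitrarily negative on the cone
    obtain ⟨n, hn⟩ := exists_nat_gt (r / (f (p + i)).re)
    have := hf2 ((n : ℝ) • (p + i)) ⟨(n : ℝ) • p, (n : ℝ) • i, smul_nonneg (by positivity) hp,
      by rw [← Complex.coe_smul]; exact smul_mem_of_isClosed hI hi _, by module⟩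
    rw [← Complex.coe_smul, map_smul, smul_eq_mul, RCLike.re_to_complex, Complex.re_ofReal_mul]
      at this
    rw [div_lt_iff_of_neg hneg] at hn
    linarith
  have hr : r ≤ 0 := by
    simpa using hf2 0 ⟨0, 0, le_rfl, I.zero_mem, by simp⟩
  have hfI : ∀ a ∈ I, f a = 0 := by
    have hre : ∀ a ∈ I, (f a).re = 0 := fun a ha ↦ by
      have h1 := hfs a ⟨0, a, le_rfl, ha, by simp⟩
      have h2 := hfs (-a) ⟨0, -a, le_rfl, I.neg_mem ha, by simp⟩
      simp only [map_neg, Complex.neg_re] at h2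
      linarith
    intro a ha
    have h3 := hre _ (smul_mem_of_isClosed hI ha Complex.I)
    apply Complex.ext
    · simpa using hre a ha
    · simpa using h3
  -- twice the hermitian part of `f`
  let g : A →ₗ[ℂ] ℂ :=
    { toFun := fun a ↦ f a + star (f (star a))
      map_add' := fun a b ↦ by simp; ring
      map_smul' := fun r a ↦ by simp; ring }
  have hg : ∀ p : A, 0 ≤ p → g p = ((2 * (f p).re : ℝ) : ℂ) := fun p hp ↦ by
    change f p + star (f (star p)) = _
    rw [(IsSelfAdjoint.of_nonneg hp).star_eq]
    simpa using Complex.add_conj (f p)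
  refine ⟨PositiveLinearMap.mk₀ g fun p hp ↦ ?_, fun a ha ↦ ?_, ?_⟩
  · rw [hg p hp]
    have := hfs p ⟨p, 0, hp, I.zero_mem, by simp⟩
    exact_mod_cast mul_nonneg zero_le_two this
  · change f a + star (f (star a)) = 0
    rw [hfI a ha, hfI _ (star_mem_of_isClosed hI ha)]
    simp
  · change 0 < g _
    rw [hg _ (star_mul_self_nonneg d)]
    have := hf1 (-(star d * d)) (Metric.mem_ball_self hε)
    simp only [map_neg, RCLike.re_to_complex] at this
    exact_mod_cast (by linarith : 0 < 2 * (f (star d * d)).re)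

/-- The quasi-states of `A` annihilating `I`, as functions on `A`; viewing them in the product
space `A → ℂ` gives the weak* topology. -/
def quasiStates (I : TwoSidedIdeal A) : Set (A → ℂ) :=
  {ψ | (∀ a b, ψ (a + b) = ψ a + ψ b) ∧ (∀ (r : ℂ) a, ψ (r • a) = r * ψ a) ∧
    (∀ a, 0 ≤ a → 0 ≤ ψ a) ∧ (∀ a, ‖ψ a‖ ≤ ‖a‖) ∧ ∀ a ∈ I, ψ a = 0}

omit [StarOrderedRing A] in
lemma isClosed_quasiStates : IsClosed (quasiStates I) := by
  simp only [quasiStates, Set.ofPred_and, Set.ofPred_forall]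
  refine .inter ?_ (.inter ?_ (.inter ?_ (.inter ?_ ?_)))
  · exact isClosed_iInter fun a ↦ isClosed_iInter fun b ↦ isClosed_eq (by fun_prop) (by fun_prop)
  · exact isClosed_iInter fun a ↦ isClosed_iInter fun b ↦ isClosed_eq (by fun_prop) (by fun_prop)
  · exact isClosed_iInter fun a ↦ isClosed_iInter fun _ ↦ isClosed_le (by fun_prop) (by fun_prop)
  · exact isClosed_iInter fun a ↦ isClosed_le (by fun_prop) (by fun_prop)
  · exact isClosed_iInter fun a ↦ isClosed_iInter fun _ ↦ isClosed_eq (by fun_prop) (by fun_prop)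

omit [StarOrderedRing A] in
lemma isCompact_quasiStates : IsCompact (quasiStates I) := by
  refine (isCompact_univ_pi fun a : A ↦ isCompact_closedBall (0 : ℂ) ‖a‖).of_isClosed_subset
    isClosed_quasiStates fun ψ hψ a _ ↦ ?_
  simpa using hψ.2.2.2.1 a

/-- Quasi-states as positive linear functionals. -/
def toPositiveLinearMap {ψ : A → ℂ} (hψ : ψ ∈ quasiStates I) : A →ₚ[ℂ] ℂ :=
  PositiveLinearMap.mk₀ { toFun := ψ, map_add' := hψ.1, map_smul' := hψ.2.1 } hψ.2.2.1

/-- Vector functionals, normalized by the squared norm `r` of the vector, are quasi-states. -/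
lemma vector_mem_quasiStates {H : Type v} [NormedAddCommGroup H] [InnerProductSpace ℂ H]
    [CompleteSpace H] (π : A →⋆ₙₐ[ℂ] (H →L[ℂ] H)) (hπ : ∀ a ∈ I, π a = 0) {x : H}
    {r : ℝ} (hr : 0 < r) (hx : ‖x‖ ^ 2 = r) :
    (fun a ↦ ((r⁻¹ : ℝ) : ℂ) * ⟪x, π a x⟫_ℂ) ∈ quasiStates I := by
  refine ⟨fun a b ↦ ?_, fun c a ↦ ?_, fun a ha ↦ ?_, fun a ↦ ?_, fun a ha ↦ ?_⟩
  · simp [mul_add]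
  · simp; ring
  · obtain ⟨b, rfl⟩ := CStarAlgebra.nonneg_iff_eq_star_mul_self.1 ha
    refine mul_nonneg (by exact_mod_cast (inv_pos.2 hr).le) ?_
    rw [map_mul, map_star, mul_apply_eq_comp, ContinuousLinearMap.star_eq_adjoint,
      ContinuousLinearMap.adjoint_inner_right, inner_self_eq_norm_sq_to_K]
    exact pow_nonneg (Complex.zero_le_real.2 (norm_nonneg (π b x))) 2
  · have h1 := norm_inner_le_norm (𝕜 := ℂ) x (π a x)
    have h2 := (π a).le_opNorm x
    have h3 := NonUnitalStarAlgHom.norm_apply_le π a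
    rw [norm_mul, Complex.norm_real, Real.norm_of_nonneg (inv_pos.2 hr).le,
      inv_mul_le_iff₀ hr, ← hx]
    calc _ ≤ ‖x‖ * (‖a‖ * ‖x‖) := h1.trans (by gcongr; exact h2.trans (by gcongr))
      _ = _ := by ring
  · simp [hπ a ha]

lemma gns_apply (φ : A →ₚ[ℂ] ℂ) (a b : A) :
    φ.gnsNonUnitalStarAlgHom a (φ.toPreGNS b : φ.PreGNS) = (φ.toPreGNS (a * b) : φ.PreGNS) := by
  rw [φ.gnsNonUnitalStarAlgHom_apply_coe, φ.leftMulMapPreGNS_apply]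
  rfl

/-- The GNS representation of a functional annihilating an ideal annihilates the ideal. -/
lemma gns_eq_zero {φ : A →ₚ[ℂ] ℂ} (hφ : ∀ a ∈ I, φ a = 0) {a : A} (ha : a ∈ I) :
    φ.gnsNonUnitalStarAlgHom a = 0 := by
  ext x
  induction x using Completion.induction_on with
  | hp => exact isClosed_eq (by fun_prop) (by fun_prop)
  | ih b =>
    obtain ⟨b, rfl⟩ := φ.toPreGNS.surjective b
    rw [gns_apply, zero_apply, ← norm_eq_zero, Completion.norm_coe,
      φ.preGNS_norm_def, φ.ofPreGNS_toPreGNS,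
      hφ _ (I.mul_mem_left _ _ (I.mul_mem_right _ _ ha))]
    simp

/-- Outside `I` there is a quasi-state annihilating `I` that is one on all left units of `d`. -/
lemma exists_quasiState (hI : IsClosed (I : Set A)) {d : A} (hd : d ∉ I) :
    ∃ ψ ∈ quasiStates I, ∀ c : A, c * d = d → ψ c = 1 := by
  obtain ⟨φ, hφI, hφd⟩ := exists_positive_functional hI hd
  have hπ : ∀ a ∈ I, φ.gnsNonUnitalStarAlgHom a = 0 := fun a ha ↦ gns_eq_zero hφI ha
  set x : φ.GNS := Completion.coe' (φ.toPreGNS d) with hx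
  have hxx : ⟪x, x⟫_ℂ = φ (star d * d) := by
    rw [hx, Completion.inner_coe, φ.preGNS_inner_def]; rfl
  have hnorm : ((‖x‖ ^ 2 : ℝ) : ℂ) = φ (star d * d) := by
    rw [← hxx, inner_self_eq_norm_sq_to_K]; norm_cast
  have hr : 0 < ‖x‖ ^ 2 := by
    rw [← hnorm] at hφd; exact_mod_cast hφd
  refine ⟨_, vector_mem_quasiStates _ hπ hr rfl, fun c hc ↦ ?_⟩
  have : φ.gnsNonUnitalStarAlgHom c x = x := by
    rw [hx, gns_apply, hc]
  simp only [this]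
  rw [hxx, ← hnorm, ← Complex.ofReal_mul, inv_mul_cancel₀ hr.ne', Complex.ofReal_one]

end Functionals

/-! ### Cyclic vectors and irreducibility -/

section Extreme

/-- One is an extreme point of the closed unit disc. -/
lemma eq_one_of_convex_combination_eq_one {s t : ℝ} (hs : 0 < s) (ht : 0 < t) (hst : s + t = 1)
    {z w : ℂ} (hz : ‖z‖ ≤ 1) (hw : ‖w‖ ≤ 1) (h : s * z + t * w = 1) : z = 1 ∧ w = 1 := by
  have h3 := congrArg Complex.re h
  rw [Complex.add_re, Complex.re_ofReal_mul, Complex.re_ofReal_mul, Complex.one_re] at h3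
  have h4 := (Complex.re_le_norm z).trans hz
  have h5 := (Complex.re_le_norm w).trans hw
  have e1 : z.re = 1 := by nlinarith
  have e2 : w.re = 1 := by nlinarith
  have key : ∀ z : ℂ, ‖z‖ ≤ 1 → z.re = 1 → z = 1 := fun z hz hre ↦ by
    have := Complex.sq_norm z
    rw [Complex.normSq_apply, hre] at this
    have : z.im * z.im = 0 := le_antisymm (by nlinarith [norm_nonneg z]) (mul_self_nonneg _)
    exact Complex.ext hre (by simpa using this)
  exact ⟨key _ hz e1, key _ hw e2⟩

variable {A : Type u} [NonUnitalCStarAlgebra A] [PartialOrder A] [StarOrderedRing A]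
  {I : TwoSidedIdeal A}

/-- Cauchy–Schwarz for contractive positive functionals on a non-unital algebra, with an
approximate unit in place of the unit. -/
lemma norm_apply_le_norm_toPreGNS (φ : A →ₚ[ℂ] ℂ) (hφ : ∀ a, ‖φ a‖ ≤ ‖a‖) (a : A) :
    ‖φ a‖ ≤ ‖φ.toPreGNS a‖ := by
  refine le_of_forall_pos_le_add fun ε hε ↦ ?_
  obtain ⟨y, hw, hw1, hy⟩ := exists_approx_right_unit (star a) hε
  set w := star (star a) * star a * y
  have h1 : ‖a - w * a‖ < ε := by
    rwa [← norm_star, star_sub, star_mul, hw.star_eq]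
  have h2 : ‖φ (w * a)‖ ≤ ‖φ.toPreGNS a‖ := by
    have h3 := norm_inner_le_norm (𝕜 := ℂ) (φ.toPreGNS w) (φ.toPreGNS a)
    rw [φ.preGNS_inner_def, φ.ofPreGNS_toPreGNS, φ.ofPreGNS_toPreGNS, hw.star_eq] at h3
    have h4 : ‖φ.toPreGNS w‖ ≤ 1 := by
      rw [φ.preGNS_norm_def, φ.ofPreGNS_toPreGNS, Real.sqrt_le_one]
      refine (Complex.re_le_norm _).trans ((hφ _).trans ?_)
      rw [CStarRing.norm_star_mul_self]
      nlinarith [norm_nonneg w]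
    nlinarith [norm_nonneg (φ.toPreGNS a)]
  calc ‖φ a‖ = ‖φ (w * a) + φ (a - w * a)‖ := by rw [← map_add]; congr 2; abel
    _ ≤ ‖φ.toPreGNS a‖ + ε := (norm_add_le _ _).trans
      (add_le_add h2 ((hφ _).trans h1.le))

/-- The cyclic vector of the GNS representation: by the Riesz representation theorem there is a
vector `ξ` with `⟪ξ, Λ a⟫ = φ a`, and then `π a ξ = Λ a`, where `Λ` is the canonical map into the
GNS space. -/
lemma exists_cyclic_vector (φ : A →ₚ[ℂ] ℂ) (hφ : ∀ a, ‖φ a‖ ≤ ‖a‖) :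
    ∃ ξ : φ.GNS, ‖ξ‖ ≤ 1 ∧ (∀ a, φ.gnsNonUnitalStarAlgHom a ξ = Completion.coe' (φ.toPreGNS a)) ∧
      ∀ a, ⟪ξ, φ.gnsNonUnitalStarAlgHom a ξ⟫_ℂ = φ a := by
  let l : φ.PreGNS →L[ℂ] ℂ := (φ.toLinearMap ∘ₗ φ.ofPreGNS.toLinearMap).mkContinuous 1 fun x ↦ by
    rw [one_mul]
    exact norm_apply_le_norm_toPreGNS φ hφ (φ.ofPreGNS x)
  let L : φ.GNS →L[ℂ] ℂ := l.extend Completion.toComplL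
  have hL : ∀ x : φ.PreGNS, L (Completion.coe' x) = l x := fun x ↦
    ContinuousLinearMap.extend_eq _ (Completion.denseRange_coe)
      (Completion.isUniformInducing_coe _) x
  let ξ := (InnerProductSpace.toDual ℂ φ.GNS).symm L
  have hξ : ∀ a, ⟪ξ, Completion.coe' (φ.toPreGNS a)⟫_ℂ = φ a := fun a ↦ by
    rw [InnerProductSpace.toDual_symm_apply, hL]; rfl
  have hcyc : ∀ a, φ.gnsNonUnitalStarAlgHom a ξ = Completion.coe' (φ.toPreGNS a) := fun a ↦ by
    refine ext_inner_right ℂ fun x ↦ ?_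
    induction x using Completion.induction_on with
    | hp => exact isClosed_eq (by fun_prop) (by fun_prop)
    | ih b =>
      obtain ⟨b, rfl⟩ := φ.toPreGNS.surjective b
      rw [← ContinuousLinearMap.adjoint_inner_right, ← ContinuousLinearMap.star_eq_adjoint,
        ← map_star, gns_apply, hξ, Completion.inner_coe, φ.preGNS_inner_def]
      rfl
  refine ⟨ξ, ?_, hcyc, fun a ↦ by rw [hcyc, hξ]⟩
  rw [LinearIsometryEquiv.norm_map]
  refine L.opNorm_le_bound zero_le_one fun x ↦ ?_
  induction x using Completion.induction_on with
  | hp => exact isClosed_le (by fun_prop) (by fun_prop)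
  | ih x =>
    rw [hL, Completion.norm_coe, one_mul]
    exact norm_apply_le_norm_toPreGNS φ hφ (φ.ofPreGNS x)

/-- The face of the quasi-states annihilating `I` that are one on every `c n`. -/
def stateFace (I : TwoSidedIdeal A) (c : ℕ → A) : Set (A → ℂ) :=
  {ψ ∈ quasiStates I | ∀ n, ψ (c n) = 1}

/-- The GNS representation of an extreme point of a face of the quasi-states is irreducible: the
projection of the cyclic vector to an invariant subspace and its complement decompose the
functional inside the face. -/
lemma isIrreducibleRep_gns {c : ℕ → A} (hc : ∀ n, ‖c n‖ ≤ 1) {ψ : A → ℂ}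
    (hψ : ψ ∈ (stateFace I c).extremePoints ℝ) :
    IsIrreducibleRep (toPositiveLinearMap hψ.1.1).gnsNonUnitalStarAlgHom ∧
      (∀ a ∈ I, (toPositiveLinearMap hψ.1.1).gnsNonUnitalStarAlgHom a = 0) ∧
      ∀ n, (toPositiveLinearMap hψ.1.1).gnsNonUnitalStarAlgHom (c n) ≠ 0 := by
  have hψc := hψ.1.2
  have hφψ : ∀ a, toPositiveLinearMap hψ.1.1 a = ψ a := fun a ↦ rfl
  set φ := toPositiveLinearMap hψ.1.1 with hφ
  set π := φ.gnsNonUnitalStarAlgHom with hπ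
  obtain ⟨ξ, hξ1, hcyc, hvec⟩ := exists_cyclic_vector φ hψ.1.1.2.2.2.1
  rw [← hπ] at hcyc hvec
  have hπI : ∀ a ∈ I, π a = 0 := fun a ha ↦ gns_eq_zero hψ.1.1.2.2.2.2 ha
  have hπc : ∀ n, π (c n) ≠ 0 := fun n h0 ↦ by
    have := hvec (c n)
    rw [h0, hφψ, hψc n] at this
    simp at this
  refine ⟨⟨fun h0 ↦ hπc 0 (by rw [h0]; rfl), fun K hK hinv ↦ ?_⟩, hπI, hπc⟩
  have hdense : ∀ M : Submodule ℂ φ.GNS, IsClosed (M : Set φ.GNS) → (∀ a, π a ξ ∈ M) → M = ⊤ := by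
    refine fun M hM h ↦ eq_top_iff.2 fun x hx ↦ ?_
    clear hx
    induction x using Completion.induction_on with
    | hp => exact hM
    | ih b =>
      obtain ⟨b, rfl⟩ := φ.toPreGNS.surjective b
      rw [← hcyc]
      exact h b
  have hinv' : ∀ a, ∀ x ∈ Kᗮ, π a x ∈ Kᗮ := fun a x hx ↦ by
    rw [Submodule.mem_orthogonal] at hx ⊢
    intro y hy
    rw [← ContinuousLinearMap.adjoint_inner_left, ← ContinuousLinearMap.star_eq_adjoint,
      ← map_star]
    exact hx _ (hinv _ _ hy)
  have : CompleteSpace K := hK.completeSpace_coe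
  obtain ⟨x, hx, y, hy, hxy⟩ := K.exists_add_mem_mem_orthogonal ξ
  have horth : ∀ x ∈ K, ∀ y ∈ Kᗮ, ⟪x, y⟫_ℂ = 0 := fun x hx y hy ↦
    (Submodule.mem_orthogonal _ _).1 hy x hx
  have horth' : ∀ x ∈ K, ∀ y ∈ Kᗮ, ⟪y, x⟫_ℂ = 0 := fun x hx y hy ↦
    (Submodule.mem_orthogonal' _ _).1 hy x hx
  rcases eq_or_ne x 0 with rfl | hx0
  · left
    rw [zero_add] at hxy
    subst hxy
    exact (Submodule.orthogonal_eq_top_iff K).1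
      (hdense _ (Submodule.isClosed_orthogonal K) fun a ↦ hinv' a _ hy)
  rcases eq_or_ne y 0 with rfl | hy0
  · right
    rw [add_zero] at hxy
    subst hxy
    exact hdense _ hK fun a ↦ hinv a _ hx
  exfalso
  have hdec : ∀ a, ψ a = ⟪x, π a x⟫_ℂ + ⟪y, π a y⟫_ℂ := fun a ↦ by
    rw [← hφψ, ← hvec, hxy, map_add, inner_add_left, inner_add_right, inner_add_right,
      horth x hx _ (hinv' a y hy), horth' _ (hinv a x hx) y hy]
    ring
  have hx' : 0 < ‖x‖ ^ 2 := by positivity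
  have hy' : 0 < ‖y‖ ^ 2 := by positivity
  have hpyth : ‖ξ‖ ^ 2 = ‖x‖ ^ 2 + ‖y‖ ^ 2 := by
    rw [hxy, sq, sq, sq]
    exact norm_add_sq_eq_norm_sq_add_norm_sq_of_inner_eq_zero _ _ (horth x hx y hy)
  have hξn : ‖ξ‖ ^ 2 = 1 := by
    refine le_antisymm (by nlinarith [norm_nonneg ξ]) ?_
    have h1 := norm_inner_le_norm (𝕜 := ℂ) ξ (π (c 0) ξ)
    rw [hvec, hφψ, hψc 0, norm_one] at h1
    have h2 := (π (c 0)).le_opNorm ξ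
    have h3 := (NonUnitalStarAlgHom.norm_apply_le π (c 0)).trans (hc 0)
    have h4 : ‖π (c 0) ξ‖ ≤ ‖ξ‖ := by nlinarith [norm_nonneg ξ]
    nlinarith [norm_nonneg ξ]
  set s := ‖x‖ ^ 2 with hs
  set t := ‖y‖ ^ 2 with ht
  have hst : s + t = 1 := by rw [← hpyth, hξn]
  set ψ₁ : A → ℂ := fun a ↦ ((s⁻¹ : ℝ) : ℂ) * ⟪x, π a x⟫_ℂ with hψ₁
  set ψ₂ : A → ℂ := fun a ↦ ((t⁻¹ : ℝ) : ℂ) * ⟪y, π a y⟫_ℂ with hψ₂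
  have hq₁ : ψ₁ ∈ quasiStates I := vector_mem_quasiStates π hπI hx' rfl
  have hq₂ : ψ₂ ∈ quasiStates I := vector_mem_quasiStates π hπI hy' rfl
  have hs0 : (s : ℂ) ≠ 0 := by exact_mod_cast hx'.ne'
  have ht0 : (t : ℂ) ≠ 0 := by exact_mod_cast hy'.ne'
  have hsum : ∀ a, (s : ℂ) * ψ₁ a + (t : ℂ) * ψ₂ a = ψ a := fun a ↦ by
    rw [hdec, hψ₁, hψ₂, Complex.ofReal_inv, Complex.ofReal_inv, mul_inv_cancel_left₀ hs0,
      mul_inv_cancel_left₀ ht0]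
  have hone : ∀ n, ψ₁ (c n) = 1 ∧ ψ₂ (c n) = 1 := fun n ↦
    eq_one_of_convex_combination_eq_one hx' hy' hst ((hq₁.2.2.2.1 (c n)).trans (hc n))
      ((hq₂.2.2.2.1 (c n)).trans (hc n)) ((hsum (c n)).trans (hψc n))
  have hext : ψ₁ = ψ := by
    refine hψ.2 ⟨hq₁, fun n ↦ (hone n).1⟩ ⟨hq₂, fun n ↦ (hone n).2⟩
      ⟨s, t, hx', hy', hst, ?_⟩
    ext a
    simpa using hsum a
  -- hence `x - s • ξ` is orthogonal to the cyclic subspace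
  have hxs : x - (s : ℂ) • ξ = 0 := by
    have hmem : (ℂ ∙ (x - (s : ℂ) • ξ))ᗮ = ⊤ := by
      refine hdense _ (Submodule.isClosed_orthogonal _) fun a ↦ ?_
      rw [Submodule.mem_orthogonal_singleton_iff_inner_right, inner_sub_left, inner_smul_left,
        hvec, hφψ, ← hext, hxy, map_add, inner_add_right, horth x hx _ (hinv' a y hy), hψ₁]
      simp [hs0]
    have : x - (s : ℂ) • ξ ∈ (ℂ ∙ (x - (s : ℂ) • ξ))ᗮ := hmem ▸ Submodule.mem_top
    rwa [Submodule.mem_orthogonal_singleton_iff_inner_right, inner_self_eq_zero] at this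
  have h1 : ⟪y, (s : ℂ) • ξ⟫_ℂ = 0 := by
    rw [← sub_eq_zero.1 hxs]
    exact horth' x hx y hy
  rw [hxy, inner_smul_right, inner_add_right, horth' x hx y hy, zero_add,
    inner_self_eq_norm_sq_to_K] at h1
  exact (mul_ne_zero hs0 (by simpa using hy0)) h1

/-- If the finite subfamilies of `c` are one at some quasi-state, witnessed by common right
multiples `d n ∉ I` on which they act as units, then `I` lies in a primitive ideal containing
no `c n`. -/
lemma exists_primitive_of_units (hI : IsClosed (I : Set A)) {c d : ℕ → A}
    (hc : ∀ n, ‖c n‖ ≤ 1) (hd : ∀ n, d n ∉ I) (hcd : ∀ n, ∀ k ≤ n, c k * d n = d n) :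
    ∃ P ∈ primitiveIdeals A, I ≤ P ∧ ∀ n, c n ∉ P := by
  have hclosed : ∀ k, IsClosed {ψ : A → ℂ | ψ (c k) = 1} := fun k ↦
    isClosed_eq (by fun_prop) (by fun_prop)
  let F : ℕ → Set (A → ℂ) := fun n ↦ quasiStates I ∩ ⋂ k ≤ n, {ψ | ψ (c k) = 1}
  have hFc : ∀ n, IsClosed (F n) := fun n ↦
    isClosed_quasiStates.inter (isClosed_biInter fun k _ ↦ hclosed k)
  have hF : (⋂ n, F n).Nonempty := by
    refine IsCompact.nonempty_iInter_of_sequence_nonempty_isCompact_isClosed F (fun n ↦ ?_)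
      (fun n ↦ ?_) (isCompact_quasiStates.of_isClosed_subset (hFc 0) Set.inter_subset_left) hFc
    · exact Set.inter_subset_inter_right _
        (Set.biInter_subset_biInter_left fun k hk ↦ Nat.le_succ_of_le hk)
    · obtain ⟨ψ, hψ, h1⟩ := exists_quasiState hI (hd n)
      exact ⟨ψ, hψ, Set.mem_iInter₂.2 fun k hk ↦ h1 _ (hcd n k hk)⟩
  have hne : (stateFace I c).Nonempty := by
    obtain ⟨ψ, hψ⟩ := hF
    rw [Set.mem_iInter] at hψ
    exact ⟨ψ, (hψ 0).1, fun n ↦ Set.mem_iInter₂.1 (hψ n).2 n le_rfl⟩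
  have hcomp : IsCompact (stateFace I c) := by
    refine isCompact_quasiStates.of_isClosed_subset ?_ (fun ψ hψ ↦ hψ.1)
    have : stateFace I c = quasiStates I ∩ ⋂ k, {ψ | ψ (c k) = 1} := by
      ext; simp [stateFace]
    rw [this]
    exact isClosed_quasiStates.inter (isClosed_iInter hclosed)
  obtain ⟨ψ, hψ⟩ := hcomp.extremePoints_nonempty hne
  obtain ⟨h1, h2, h3⟩ := isIrreducibleRep_gns hc hψ
  exact ⟨_, ⟨_, inferInstance, inferInstance, inferInstance, _, h1, rfl⟩,
    fun a ha ↦ (TwoSidedIdeal.mem_ker _).2 (h2 a ha),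
    fun n hn ↦ h3 n ((TwoSidedIdeal.mem_ker _).1 hn)⟩

end Extreme

/-! ### Invariant ideals -/

section Invariant

variable {A : Type u} [NonUnitalCStarAlgebra A] {G : Type v} [Group G] {α : G →* (A ≃⋆ₐ[ℂ] A)}
  {I J : TwoSidedIdeal A}

lemma action_mul_apply (g h : G) (a : A) : α (g * h) a = α g (α h a) := by
  rw [map_mul]; rfl

lemma action_inv_apply_self (g : G) (a : A) : α g⁻¹ (α g a) = a := by
  rw [← action_mul_apply, inv_mul_cancel, map_one]; rfl

lemma action_apply_inv_self (g : G) (a : A) : α g (α g⁻¹ a) = a := by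
  rw [← action_mul_apply, mul_inv_cancel, map_one]; rfl

lemma mem_image_action_iff {S : Set A} {g : G} {a : A} : a ∈ α g '' S ↔ α g⁻¹ a ∈ S := by
  constructor
  · rintro ⟨b, hb, rfl⟩
    rwa [action_inv_apply_self]
  · exact fun h ↦ ⟨_, h, action_apply_inv_self g a⟩

lemma action_mem (hJ : J ∈ invariantIdeals α) {a : A} (ha : a ∈ J) (g : G) : α g a ∈ J := by
  have : α g a ∈ α g '' (J : Set A) := ⟨a, ha, rfl⟩
  rwa [hJ.2 g] at this

lemma mem_invariantIdeals_of_action_mem (hJ : IsClosed (J : Set A))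
    (h : ∀ a ∈ J, ∀ g : G, α g a ∈ J) : J ∈ invariantIdeals α := by
  refine ⟨hJ, fun g ↦ Set.Subset.antisymm ?_ fun a ha ↦ mem_image_action_iff.2 (h a ha g⁻¹)⟩
  rintro _ ⟨a, ha, rfl⟩
  exact h a ha g

/-- The two-sided ideal of those `y` with `z * a * y ∈ I` for all `z ∈ S` and all `a`. -/
def rightQuotient (I : TwoSidedIdeal A) (S : Set A) : TwoSidedIdeal A :=
  .mk' {y | ∀ z ∈ S, ∀ a, z * a * y ∈ I} (by simp [I.zero_mem])
    (fun hx hy z hz a ↦ by rw [mul_add]; exact I.add_mem (hx z hz a) (hy z hz a))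
    (fun hx z hz a ↦ by rw [mul_neg]; exact I.neg_mem (hx z hz a))
    (fun {x y} hy z hz a ↦ by rw [← mul_assoc, mul_assoc z]; exact hy z hz _)
    (fun hx z hz a ↦ by rw [← mul_assoc]; exact I.mul_mem_right _ _ (hx z hz a))

/-- The two-sided ideal of those `z` with `z * a * y ∈ I` for all `y ∈ S` and all `a`. -/
def leftQuotient (I : TwoSidedIdeal A) (S : Set A) : TwoSidedIdeal A :=
  .mk' {z | ∀ y ∈ S, ∀ a, z * a * y ∈ I} (by simp [I.zero_mem])
    (fun hx hy z hz a ↦ by rw [add_mul, add_mul]; exact I.add_mem (hx z hz a) (hy z hz a))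
    (fun hx z hz a ↦ by rw [neg_mul, neg_mul]; exact I.neg_mem (hx z hz a))
    (fun hy z hz a ↦ by
      rw [mul_assoc, mul_assoc, ← mul_assoc _ a]; exact I.mul_mem_left _ _ (hy z hz a))
    (fun {x y} hx z hz a ↦ by rw [mul_assoc x]; exact hx z hz _)

lemma mem_rightQuotient {S : Set A} {y : A} :
    y ∈ rightQuotient I S ↔ ∀ z ∈ S, ∀ a, z * a * y ∈ I := TwoSidedIdeal.mem_mk' ..

lemma mem_leftQuotient {S : Set A} {z : A} :
    z ∈ leftQuotient I S ↔ ∀ y ∈ S, ∀ a, z * a * y ∈ I := TwoSidedIdeal.mem_mk' ..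

lemma rightQuotient_mem_invariantIdeals (hI : I ∈ invariantIdeals α) {S : Set A}
    (hS : ∀ z ∈ S, ∀ g : G, α g z ∈ S) : rightQuotient I S ∈ invariantIdeals α := by
  refine mem_invariantIdeals_of_action_mem ?_ fun y hy g ↦ ?_
  · simp only [rightQuotient, TwoSidedIdeal.coe_mk', Set.ofPred_forall]
    exact isClosed_iInter fun z ↦ isClosed_iInter fun _ ↦ isClosed_iInter fun a ↦
      hI.1.preimage (continuous_const_mul (z * a))
  · rw [mem_rightQuotient] at hy ⊢
    intro z hz a
    have := action_mem hI (hy _ (hS z hz g⁻¹) (α g⁻¹ a)) g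
    rwa [map_mul, map_mul, action_apply_inv_self, action_apply_inv_self] at this

lemma leftQuotient_mem_invariantIdeals (hI : I ∈ invariantIdeals α) {S : Set A}
    (hS : ∀ z ∈ S, ∀ g : G, α g z ∈ S) : leftQuotient I S ∈ invariantIdeals α := by
  refine mem_invariantIdeals_of_action_mem ?_ fun y hy g ↦ ?_
  · simp only [leftQuotient, TwoSidedIdeal.coe_mk', Set.ofPred_forall]
    exact isClosed_iInter fun z ↦ isClosed_iInter fun _ ↦ isClosed_iInter fun a ↦
      hI.1.preimage ((continuous_mul_const z).comp (continuous_mul_const a))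
  · rw [mem_leftQuotient] at hy ⊢
    intro z hz a
    have := action_mem hI (hy _ (hS z hz g⁻¹) (α g⁻¹ a)) g
    rwa [map_mul, map_mul, action_apply_inv_self, action_apply_inv_self] at this

/-- The elementwise form of `G`-primeness. -/
lemma exists_mul_mul_action_notMem (hI : I ∈ gPrimeIdeals α) {x b : A} (hx : x ∉ I)
    (hb : b ∉ I) : ∃ g a, x * a * α g b ∉ I := by
  by_contra! H
  set J₁ := leftQuotient I (Set.range fun g : G ↦ α g b) with hJ₁
  have hS : ∀ z ∈ Set.range fun g : G ↦ α g b, ∀ h : G, α h z ∈ Set.range fun g : G ↦ α g b := by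
    rintro _ ⟨g, rfl⟩ h
    exact ⟨h * g, action_mul_apply h g b⟩
  have hJ₁i : J₁ ∈ invariantIdeals α := leftQuotient_mem_invariantIdeals hI.1 hS
  set J₂ := rightQuotient I (J₁ : Set A)
  have hJ₂i : J₂ ∈ invariantIdeals α :=
    rightQuotient_mem_invariantIdeals hI.1 fun z hz g ↦ action_mem hJ₁i hz g
  have hle : J₁ ⊓ J₂ ≤ I := fun c hc ↦
    mem_of_forall_mul_mul_mem hI.1.1 fun a ↦ mem_rightQuotient.1 hc.2 c hc.1 a
  rcases hI.2.2 J₁ hJ₁i J₂ hJ₂i hle with h | h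
  · refine hx (h (mem_leftQuotient.2 ?_))
    rintro _ ⟨g, rfl⟩ a
    exact H g a
  · refine hb (h (mem_rightQuotient.2 fun z hz a ↦ ?_))
    have := mem_leftQuotient.1 hz (α 1 b) ⟨1, rfl⟩ a
    rwa [map_one] at this

/-! ### Primitive ideals are prime -/

/-- The common kernel of a nonzero ideal in an irreducible representation is a closed invariant
subspace, hence trivial. -/
lemma le_or_le_of_inf_le_of_mem_primitiveIdeals {P J₁ J₂ : TwoSidedIdeal A}
    (hP : P ∈ primitiveIdeals A) (hJ : J₁ ⊓ J₂ ≤ P) : J₁ ≤ P ∨ J₂ ≤ P := by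
  obtain ⟨H, _, _, _, π, ⟨-, hirr⟩, rfl⟩ := hP
  let K : Submodule ℂ H :=
    { carrier := {v | ∀ a ∈ J₁, π a v = 0}
      zero_mem' := by simp
      add_mem' := fun h h' a ha ↦ by rw [map_add, h a ha, h' a ha, add_zero]
      smul_mem' := fun r v h a ha ↦ by rw [map_smul, h a ha, smul_zero] }
  have hK : IsClosed (K : Set H) := by
    have : (K : Set H) = ⋂ a ∈ J₁, {v | π a v = 0} := by ext; simp [K]
    rw [this]
    exact isClosed_biInter fun a _ ↦ isClosed_eq (by fun_prop) (by fun_prop)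
  rcases hirr K hK fun a v hv b hb ↦ by
      rw [← mul_apply_eq_comp, ← map_mul]
      exact hv _ (J₁.mul_mem_right _ _ hb) with h | h
  · right
    refine fun b hb ↦ (TwoSidedIdeal.mem_ker _).2 (ContinuousLinearMap.ext fun v ↦ ?_)
    have hv : π b v ∈ K := fun a ha ↦ by
      have := (TwoSidedIdeal.mem_ker π).1
        (hJ ⟨J₁.mul_mem_right a b ha, J₂.mul_mem_left a b hb⟩)
      rw [← mul_apply_eq_comp, ← map_mul, this, zero_apply]
    rw [h] at hv
    exact hv
  · left
    refine fun a ha ↦ (TwoSidedIdeal.mem_ker _).2 (ContinuousLinearMap.ext fun v ↦ ?_)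
    have hv : v ∈ K := h ▸ Submodule.mem_top
    exact hv a ha

lemma gPrimitiveIdeals_subset_gPrimeIdeals : gPrimitiveIdeals α ⊆ gPrimeIdeals α := by
  rintro I ⟨hI, P, hP, hIP⟩
  have hle : ∀ J ∈ invariantIdeals α, J ≤ P → J ≤ I := fun J hJ h a ha ↦ by
    have : a ∈ (I : Set A) := by
      rw [hIP]
      exact Set.mem_iInter.2 fun g ↦ mem_image_action_iff.2 (h (action_mem hJ ha g⁻¹))
    exact this
  have hIleP : I ≤ P := fun a ha ↦ by
    have : a ∈ (I : Set A) := ha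
    rw [hIP, Set.mem_iInter] at this
    have := mem_image_action_iff.1 (this 1)
    rwa [inv_one, map_one] at this
  refine ⟨hI, fun h ↦ ?_, fun J₁ h₁ J₂ h₂ h ↦ ?_⟩
  · obtain ⟨H, _, _, _, π, ⟨hne, -⟩, rfl⟩ := hP
    refine hne (NonUnitalStarAlgHom.ext fun a ↦ (TwoSidedIdeal.mem_ker π).1 (hIleP ?_))
    rw [h]
    exact TwoSidedIdeal.mem_top _
  · exact (le_or_le_of_inf_le_of_mem_primitiveIdeals hP (h.trans hIleP)).imp
      (hle J₁ h₁) (hle J₂ h₂)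

/-! ### Invariantly prime ideals are invariantly primitive -/

/-- Given `x, b ∉ I`, some translate of `b` generates a contraction `c` that acts as a left unit
on a right multiple of `x` outside `I`. -/
lemma exists_unit_step (hI : I ∈ gPrimeIdeals α) {x b : A} (hx : x ∉ I) (hb : b ∉ I) :
    ∃ c r p q : A, ∃ g : G, ‖c‖ ≤ 1 ∧ x * r ∉ I ∧ c * (x * r) = x * r ∧ c = p * α g b * q := by
  obtain ⟨g, a, hz⟩ := exists_mul_mul_action_notMem hI hx hb
  set z := x * a * α g b with hzdef
  -- `h = z * star z`, written as `star y * y` to match the cutoff lemmas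
  have hy : star (star z) * star z ∉ I := fun h ↦ by
    have := star_mem_of_isClosed hI.1.1 (mem_of_star_mul_self_mem hI.1.1 h)
    rw [star_star] at this
    exact hz this
  have hsa : IsSelfAdjoint (star (star z) * star z) := .star_mul_self _
  obtain ⟨μ, hμ, hd⟩ := exists_truncate_notMem hI.1.1 hy
  obtain ⟨r, hr⟩ := exists_truncate_eq_mul hμ hsa
  have hxr : truncate μ (star (star z) * star z) = x * (a * α g b * star z * r) := by
    rw [hr, star_star, hzdef]
    simp only [mul_assoc]
  refine ⟨star (star z) * star z * reciprocalCutoff μ (star (star z) * star z), _, x * a,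
    star z * reciprocalCutoff μ (star (star z) * star z), g,
    norm_mul_reciprocalCutoff_le_one hμ _, hxr ▸ hd, ?_, ?_⟩
  · rw [← hxr]
    exact mul_reciprocalCutoff_mul_truncate hμ hsa
  · rw [star_star, ← hzdef, mul_assoc z]

/-- A countable family outside a `G`-prime ideal can be avoided, up to translation, by a
primitive ideal above it. -/
lemma exists_primitive_forall_action_notMem (hI : I ∈ gPrimeIdeals α) {b : ℕ → A}
    (hb : ∀ n, b n ∉ I) : ∃ P ∈ primitiveIdeals A, I ≤ P ∧ ∀ n, ∃ g : G, α g (b n) ∉ P := by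
  choose c r p q g hc hr hcr hpq using
    fun (n : ℕ) (x : {x : A // x ∉ I}) ↦ exists_unit_step hI x.2 (hb n)
  let d : ℕ → {x : A // x ∉ I} := fun n ↦
    Nat.rec ⟨b 0, hb 0⟩ (fun n x ↦ ⟨x.1 * r n x, hr n x⟩) n
  have hd : ∀ n, (d (n + 1)).1 = (d n).1 * r n (d n) := fun n ↦ rfl
  have hcd : ∀ n, ∀ k ≤ n, c k (d k) * (d (n + 1)).1 = (d (n + 1)).1 := by
    intro n
    induction n with
    | zero =>
      intro k hk
      obtain rfl : k = 0 := by omega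
      exact hcr 0 (d 0)
    | succ n ih =>
      intro k hk
      rcases Nat.lt_or_eq_of_le hk with hk | rfl
      · rw [hd (n + 1), ← mul_assoc, ih k (by omega)]
      · exact hcr (n + 1) (d (n + 1))
  let := CStarAlgebra.spectralOrder A
  have := CStarAlgebra.spectralOrderedRing A
  obtain ⟨P, hP, hIP, hcP⟩ := exists_primitive_of_units hI.1.1 (c := fun n ↦ c n (d n))
    (d := fun n ↦ (d (n + 1)).1) (fun n ↦ hc n _) (fun n ↦ (d (n + 1)).2) hcd
  refine ⟨P, hP, hIP, fun n ↦ ⟨g n (d n), fun h ↦ hcP n ?_⟩⟩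
  simp only [hpq n (d n)]
  exact P.mul_mem_right _ _ (P.mul_mem_left _ _ h)

lemma gPrimeIdeals_subset_gPrimitiveIdeals [TopologicalSpace.SeparableSpace A] :
    gPrimeIdeals α ⊆ gPrimitiveIdeals α := by
  intro I hI
  refine ⟨hI.1, ?_⟩
  obtain ⟨x₀, hx₀⟩ : ∃ x, x ∉ I := by
    by_contra! H
    exact hI.2.1 (eq_top_iff.2 fun x _ ↦ H x)
  obtain ⟨D, hDc, hD⟩ := TopologicalSpace.exists_countable_dense A
  let B : Set A := insert x₀ ({y | ∃ a ∈ D, ∃ n : ℕ,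
    y = truncate (1 / ((n : ℝ) + 1)) (star a * a)} ∩ {y | y ∉ I})
  have hB : B.Countable := by
    refine (Set.Countable.mono Set.inter_subset_left ?_).insert _
    refine ((hDc.prod (Set.countable_univ (α := ℕ))).image
      fun t ↦ truncate (1 / ((t.2 : ℝ) + 1)) (star t.1 * t.1)).mono ?_
    rintro _ ⟨a, ha, n, rfl⟩
    exact ⟨(a, n), ⟨ha, trivial⟩, rfl⟩
  obtain ⟨b, hbB⟩ := hB.exists_eq_range ⟨x₀, Set.mem_insert _ _⟩
  have hb : ∀ n, b n ∉ I := fun n ↦ by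
    have : b n ∈ B := hbB ▸ Set.mem_range_self n
    rcases this with h | h
    · rwa [h]
    · exact h.2
  obtain ⟨P, hP, hIP, hbP⟩ := exists_primitive_forall_action_notMem hI hb
  refine ⟨P, hP, Set.Subset.antisymm (fun a ha ↦ Set.mem_iInter.2 fun g ↦
    mem_image_action_iff.2 (hIP (action_mem hI.1 ha g⁻¹))) fun x hx ↦ ?_⟩
  by_contra hxI
  have hxP : ∀ g, α g x ∈ P := fun g ↦ by
    have := mem_image_action_iff.1 (Set.mem_iInter.1 hx g⁻¹)
    rwa [inv_inv] at this
  have hxxI : star x * x ∉ I := fun h ↦ hxI (mem_of_star_mul_self_mem hI.1.1 h)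
  obtain ⟨ε, hε, hdist⟩ : ∃ ε > 0, ∀ y ∈ I, ε ≤ ‖star x * x - y‖ := by
    by_contra! H
    exact hxxI (mem_of_forall_exists_norm_sub_lt hI.1.1 H)
  obtain ⟨n, hn⟩ := exists_nat_one_div_lt (half_pos hε)
  set δ : ℝ := 1 / ((n : ℝ) + 1) with hδ
  have hδ0 : 0 < δ := by positivity
  obtain ⟨a, haD, ha⟩ : ∃ a ∈ D, ‖star x * x - star a * a‖ < δ := by
    have hopen : IsOpen {a : A | ‖star x * x - star a * a‖ < δ} :=
      isOpen_lt (by fun_prop) (by fun_prop)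
    obtain ⟨a, ha, haD⟩ := hD.inter_open_nonempty _ hopen ⟨x, by simpa using hδ0⟩
    exact ⟨a, haD, ha⟩
  have htI : truncate δ (star a * a) ∉ I := fun h ↦ by
    have h1 := hdist _ h
    have h2 := norm_sub_truncate_le hδ0.le a
    have h3 := norm_sub_le_norm_sub_add_norm_sub (star x * x) (star a * a)
      (truncate δ (star a * a))
    linarith
  obtain ⟨m, hm⟩ : truncate δ (star a * a) ∈ Set.range b :=
    hbB ▸ Or.inr ⟨⟨a, haD, n, rfl⟩, htI⟩
  obtain ⟨g, hg⟩ := hbP m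
  obtain ⟨H, _, _, _, π, -, rfl⟩ := hP
  -- in the representation `π ∘ α g` the element `x` vanishes, so `star a * a` has norm below `δ`
  let σ : A →⋆ₙₐ[ℂ] (H →L[ℂ] H) := π.comp (α g : A →⋆ₙₐ[ℂ] A)
  have hσ : ∀ y, σ y = π (α g y) := fun y ↦ rfl
  have hσx : σ x = 0 := (TwoSidedIdeal.mem_ker π).1 (hxP g)
  refine hg ((TwoSidedIdeal.mem_ker π).2 ?_)
  rw [hm, ← hσ]
  refine map_truncate_eq_zero σ hδ0.le (.star_mul_self a) ?_
  have h1 := NonUnitalStarAlgHom.norm_apply_le σ (star x * x - star a * a)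
  rw [map_sub, map_mul σ (star x), hσx, mul_zero, zero_sub, norm_neg] at h1
  exact h1.trans ha.le

end Invariant

end CStarSystem

theorem mainTheorem5 {A : Type*} [NonUnitalCStarAlgebra A] [TopologicalSpace.SeparableSpace A]
    {G : Type*} [Group G] (α : G →* (A ≃⋆ₐ[ℂ] A)) :
    CStarSystem.gPrimeIdeals α = CStarSystem.gPrimitiveIdeals α :=
  Set.Subset.antisymm CStarSystem.gPrimeIdeals_subset_gPrimitiveIdeals
    CStarSystem.gPrimitiveIdeals_subset_gPrimeIdeals
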